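/- Let $\kappa$ and $\lambda$ be infinite cardinals. The following are equivalent. (a) There is a graph with exactly $\lambda$ vertices whose chromatic number is $\kappa^+$ and which does not have the complete graph $K_{\kappa^+}$ on $\kappa^+$ vertices as a minor. (b) There is a tree $T$ of cardinality $\lambda$ which is not $\kappa$-special and in which there is no branch of length at least $\kappa^+$ (that is, every branch has order type less than $\kappa^+$). Here graphs are simple and undirected, and the chromatic number of a graph is the least cardinal $\mu$ for which it has a proper coloring with $\mu$ colors. A graph $H$ is a minor of a graph $G$ if there are pairwise disjoint non-empty sets $X_u\subseteq V(G)$, for $u\in V(H)$, each inducing a connected subgraph of $G$, such that for every edge $\{u,v\}$ of $H$ some edge of $G$ joins a vertex of $X_u$ to a vertex of $X_v$. A tree is a partially ordered set $(T,\le)$ (possibly with several minimal elements) in which $\{s\in T: s<t\}$ is well-ordered for every $t\in T$. A branch is a maximal chain of $T$, and its length is its order type. The tree $T$ is $\kappa$-special if there is a function $f:T\to\kappa$ whose restriction to every chain of $T$ is injective. -/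

import Mathlib

universe u v w

open Cardinal

namespace HadwigerTree

/-- The chromatic number of a graph as a cardinal: the least cardinal `μ` such that the graph has a
proper coloring with a set of `μ` colors. -/
noncomputable def chromaticCard {V : Type u} (G : SimpleGraph V) : Cardinal.{u} :=
  sInf {μ : Cardinal.{u} | Nonempty (G.Coloring μ.ord.ToType)}

/-- The infimum defining the chromatic number is over a nonempty set, so it is attained. -/
theorem nonempty_coloring_chromaticCard {V : Type u} (G : SimpleGraph V) :
    Nonempty (G.Coloring (chromaticCard G).ord.ToType) := by
  have hne : {μ : Cardinal.{u} | Nonempty (G.Coloring μ.ord.ToType)}.Nonempty := by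
    refine ⟨#V, ?_⟩
    have h : #V = #((#V).ord.ToType) := (Cardinal.mk_ord_toType _).symm
    obtain ⟨e⟩ := Cardinal.eq.1 h
    exact ⟨G.recolorOfEquiv e G.selfColoring⟩
  exact csInf_mem hne

/-- `H` is a minor of `G`: there are pairwise disjoint vertex sets of `G`, indexed by the vertices
of `H`, each inducing a connected (in particular nonempty) subgraph, such that adjacent vertices of
`H` have sets joined by an edge of `G`. -/
def IsMinor {W : Type w} {V : Type v} (H : SimpleGraph W) (G : SimpleGraph V) : Prop :=
  ∃ X : W → Set V,
    Pairwise (fun a b => Disjoint (X a) (X b)) ∧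
    (∀ a, (G.induce (X a)).Connected) ∧
    ∀ a b, H.Adj a b → ∃ x ∈ X a, ∃ y ∈ X b, G.Adj x y

/-- The complete graph on `κ` vertices. -/
def completeGraphCard (κ : Cardinal.{u}) : SimpleGraph κ.ord.ToType :=
  ⊤

/-- A (set-theoretic) tree: a partial order in which the set of strict predecessors of every
element is well-ordered. Several roots are allowed. -/
class IsOrderTree (T : Type u) [PartialOrder T] : Prop where
  isWellOrder_Iio : ∀ t : T, IsWellOrder (Set.Iio t) (· < ·)

/-- A tree is `κ`-special if there is a function to `κ` that is injective on chains. -/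
def IsSpecial (κ : Cardinal.{u}) (T : Type u) [PartialOrder T] : Prop :=
  ∃ f : T → κ.ord.ToType, ∀ C : Set T, IsChain (· ≤ ·) C → Set.InjOn f C

/-- A branch of a tree is a maximal chain. -/
def IsBranch {T : Type u} [PartialOrder T] (b : Set T) : Prop :=
  IsMaxChain (· ≤ ·) b

/-- The strict order of a tree is well-founded. -/
theorem wellFounded_lt (T : Type u) [PartialOrder T] [IsOrderTree T] :
    WellFounded (fun s t : T => s < t) := by
  refine ⟨fun t => Acc.intro t fun s hs => ?_⟩
  have key : ∀ x : Set.Iio t, Acc (fun s t : T => s < t) x.1 := by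
    intro x
    refine (IsOrderTree.isWellOrder_Iio t).wf.induction
      (C := fun x : Set.Iio t => Acc (fun s t : T => s < t) x.1) x ?_
    intro y ih
    exact Acc.intro _ fun z hz => ih ⟨z, lt_trans hz y.2⟩ hz
  exact key ⟨s, hs⟩

/-- Every branch of a tree is well-ordered. -/
theorem IsBranch.isWellOrder {T : Type u} [PartialOrder T] [IsOrderTree T] {b : Set T}
    (hb : IsBranch b) : IsWellOrder b (· < ·) where
  wf := InvImage.wf (fun x : b => x.1) (wellFounded_lt T)
  trichotomous := by
    intro x y hxy hyx
    rcases hb.isChain.total x.2 y.2 with h | h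
    · by_contra hn
      exact hxy (lt_of_le_of_ne h hn)
    · by_contra hn
      exact hyx (lt_of_le_of_ne h (fun e => hn e.symm))

/-- The length of a branch of a tree: its order type. -/
noncomputable def branchLength {T : Type u} [PartialOrder T] [IsOrderTree T] (b : Set T)
    (hb : IsBranch b) : Ordinal.{u} :=
  @Ordinal.type b (· < ·) hb.isWellOrder

end HadwigerTree

/-!
From a tree to a graph, take the comparability graph. Its proper colorings with `κ` colors are the
maps witnessing that the tree is `κ`-special, and a strictly monotone map to `κ⁺` colors it when
all chains have at most `κ` elements. Every connected set of vertices has a least element, so the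
least elements of the branch sets of a complete minor form a chain.

From a graph to a tree, start with the whole graph and repeatedly remove, from every component of
what is left, a connected set of at most `κ` vertices, its core, which sees every neighbor of the
component. A component at stage `i < κ⁺` has at most `κ` neighbors, since they all lie in the
cores of the components containing it at earlier stages; hence there are always such cores. In a
decreasing sequence of components through all stages below `κ⁺`, cofinally many cores have
neighbors in all later components, and these cores form a `K_{κ⁺}` minor. Without such a minor,
every vertex is therefore removed, and ordering the vertices by stage and component gives a tree
order in which adjacent vertices are comparable. The vertices of a chain stay in a common
component until they are removed, so they are used up before stage `κ⁺`, and each stage removes at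
most `κ` of them.
-/

namespace HadwigerTree

section RegularOrder

variable {I : Type u} [LinearOrder I]

theorem exists_strictMono_of_mk_Iio_lt_cof {T : Type u} [Preorder T] [WellFoundedLT T]
    (h : ∀ t : T, #(Set.Iio t) < Order.cof I) : ∃ f : T → I, StrictMono f := by
  have exists_above (t : T) (g : Set.Iio t → I) : ∃ i, ∀ s, g s < i := by
    have hg : ¬ IsCofinal (Set.range g) := fun hg =>
      (Order.cof_le hg).not_gt (mk_range_le.trans_lt (h t))
    simpa only [Set.forall_mem_range] using not_isCofinal_iff.1 hg
  choose above lt_above using exists_above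
  let f : T → I := WellFoundedLT.fix fun t g => above t fun s => g s.1 s.2
  refine ⟨f, fun s t hst => ?_⟩
  have hft : f t = above t fun s => f s := WellFoundedLT.fix_eq _ t
  exact hft ▸ lt_above t (fun s => f s) ⟨s, hst⟩

variable [WellFoundedLT I]

theorem exists_gt_forall_lt_map_le (hI : ∀ i : I, #(Set.Iio i) < Order.cof I)
    (hω : ℵ₀ < Order.cof I) (b : I → I) (j : I) : ∃ i > j, ∀ k < i, b k ≤ i := by
  have exists_next (i : I) : ∃ i', i < i' ∧ ∀ k < i, b k < i' := by
    have hcard : #(insert i (b '' Set.Iio i) : Set I) < Order.cof I :=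
      mk_insert_le.trans_lt
        (add_lt_of_lt hω.le (mk_image_le.trans_lt (hI i)) (one_lt_aleph0.trans hω))
    obtain ⟨i', hi'⟩ := not_isCofinal_iff.1 fun h => (Order.cof_le h).not_gt hcard
    exact ⟨i', hi' i (Set.mem_insert _ _), fun k hk =>
      hi' _ (Set.mem_insert_of_mem _ ⟨k, hk, rfl⟩)⟩
  choose next lt_next map_lt_next using exists_next
  let t (n : ℕ) : I := next^[n] j
  have t_succ (n : ℕ) : t (n + 1) = next (t n) := Function.iterate_succ_apply' next n j
  have hbdd : ∃ i, ∀ n, t n ≤ i := by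
    have hcard : #(Set.range t) < Order.cof I :=
      (mk_le_aleph0_iff.2 (Set.countable_range t)).trans_lt hω
    obtain ⟨i, hi⟩ := not_isCofinal_iff.1 fun h => (Order.cof_le h).not_gt hcard
    exact ⟨i, fun n => (hi _ ⟨n, rfl⟩).le⟩
  obtain ⟨i, hi, hmin⟩ := _root_.wellFounded_lt.has_min {i | ∀ n, t n ≤ i} hbdd
  refine ⟨i, (lt_next j).trans_le (hi 1), fun k hk => ?_⟩
  obtain ⟨n, hn⟩ : ∃ n, k < t n := by
    by_contra! h
    exact hmin k h hk
  exact (map_lt_next _ k hn).le.trans (t_succ n ▸ hi (n + 1))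

/- If the set were bounded by `j`, every `k ≥ j` would have some `b k` with `¬ A k (b k)`; a limit
stage closed under `b` then violates `hfreq`. -/
theorem isCofinal_setOf_forall_gt (hI : ∀ i : I, #(Set.Iio i) < Order.cof I)
    (hω : ℵ₀ < Order.cof I) {A : I → I → Prop}
    (hanti : ∀ ⦃k i i'⦄, k < i → i ≤ i' → A k i' → A k i)
    (hfreq : ∀ ⦃j i⦄, j < i → ∃ k, j ≤ k ∧ k < i ∧ A k i) :
    IsCofinal {k | ∀ i, k < i → A k i} := by
  by_contra hbdd
  obtain ⟨j, hj⟩ := not_isCofinal_iff.1 hbdd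
  have exists_fail (k : I) : ∃ i, j ≤ k → k < i ∧ ¬ A k i := by
    by_cases hk : k ∈ {k | ∀ i, k < i → A k i}
    · exact ⟨k, fun hjk => absurd (hj k hk) hjk.not_gt⟩
    · simp only [Set.mem_ofPred_eq, not_forall] at hk
      obtain ⟨i, hki, hA⟩ := hk
      exact ⟨i, fun _ => ⟨hki, hA⟩⟩
  choose b hb using exists_fail
  obtain ⟨i, hji, hbi⟩ := exists_gt_forall_lt_map_le hI hω b j
  obtain ⟨k, hjk, hki, hA⟩ := hfreq hji
  exact (hb k hjk).2 (hanti (hb k hjk).1 (hbi k hki) hA)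

end RegularOrder

theorem mk_Iio_toType_ord_succ_le {κ : Cardinal.{u}} (i : (Order.succ κ).ord.ToType) :
    #(Set.Iio i) ≤ κ := by
  rw [← Order.lt_succ_iff]
  simpa only [mk_ord_toType] using mk_Iio_lt i (by simp)

theorem cof_toType_ord_succ {κ : Cardinal.{u}} (hκ : ℵ₀ ≤ κ) :
    Order.cof (Order.succ κ).ord.ToType = Order.succ κ := by
  rw [Ordinal.cof_toType, (isRegular_succ hκ).cof_ord]

section Coloring

variable {V : Type u} {G H : SimpleGraph V} {κ : Cardinal.{u}}

theorem chromaticCard_le_iff : chromaticCard G ≤ κ ↔ Nonempty (G.Coloring κ.ord.ToType) := by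
  refine ⟨fun h => ?_, fun h => csInf_le' h⟩
  obtain ⟨c⟩ := nonempty_coloring_chromaticCard G
  have hmk : #(chromaticCard G).ord.ToType ≤ #κ.ord.ToType := by simpa only [mk_ord_toType] using h
  obtain ⟨e⟩ := hmk
  exact ⟨G.recolorOfEmbedding e c⟩

theorem chromaticCard_mono (h : G ≤ H) : chromaticCard G ≤ chromaticCard H := by
  obtain ⟨c⟩ := nonempty_coloring_chromaticCard H
  exact chromaticCard_le_iff.2 ⟨c.comp (.ofLE h)⟩

end Coloring

theorem IsMinor.of_injective_hom {V : Type u} {W : Type v} {W' : Type w} {G : SimpleGraph V}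
    {H : SimpleGraph W} {H' : SimpleGraph W'} (h : IsMinor H G) (f : H' →g H)
    (hf : Function.Injective f) : IsMinor H' G := by
  obtain ⟨X, hdisj, hconn, hadj⟩ := h
  exact ⟨X ∘ f, fun a b hab => hdisj (hf.ne hab), fun a => hconn (f a),
    fun a b hab => hadj _ _ (f.map_adj hab)⟩

/-- The comparability graph of an order: distinct elements are adjacent when they are comparable. -/
def comparabilityGraph (T : Type u) [LE T] : SimpleGraph T :=
  .fromRel (· ≤ ·)

theorem isSpecial_iff_chromaticCard_le {κ : Cardinal.{u}} {T : Type u} [PartialOrder T] :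
    IsSpecial κ T ↔ chromaticCard (comparabilityGraph T) ≤ κ := by
  rw [chromaticCard_le_iff]
  constructor
  · rintro ⟨f, hf⟩
    refine ⟨.mk f ?_⟩
    rintro a b ⟨hne, hab | hba⟩ hfab
    · exact hne (hf {a, b} (.pair hab) (by simp) (by simp) hfab)
    · exact hne (hf {b, a} (.pair hba) (by simp) (by simp) hfab)
  · rintro ⟨c⟩
    refine ⟨c, fun C hC a ha b hb hab => ?_⟩
    by_contra hne
    exact c.valid (v := a) (w := b) ⟨hne, hC.total ha hb⟩ hab

theorem chromaticCard_comparabilityGraph_le {κ : Cardinal.{u}} (hκ : ℵ₀ ≤ κ) {T : Type u}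
    [PartialOrder T] [WellFoundedLT T] (h : ∀ t : T, #(Set.Iio t) ≤ κ) :
    chromaticCard (comparabilityGraph T) ≤ Order.succ κ := by
  obtain ⟨f, hf⟩ := exists_strictMono_of_mk_Iio_lt_cof (I := (Order.succ κ).ord.ToType) fun t : T =>
    (h t).trans_lt ((Order.lt_succ κ).trans_eq (cof_toType_ord_succ hκ).symm)
  refine chromaticCard_le_iff.2 ⟨.mk f ?_⟩
  rintro a b ⟨hne, hab | hba⟩
  · exact (hf (hab.lt_of_ne hne)).ne
  · exact (hf (hba.lt_of_ne' hne)).ne'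

section Tree

variable {T : Type u} [PartialOrder T] [IsOrderTree T]

theorem isChain_Iio (t : T) : IsChain (· ≤ ·) (Set.Iio t) := by
  intro a ha b hb hab
  have := IsOrderTree.isWellOrder_Iio t
  rcases trichotomous_of (· < ·) (⟨a, ha⟩ : Set.Iio t) ⟨b, hb⟩ with h | h | h
  · exact .inl h.le
  · exact absurd (congrArg Subtype.val h) hab
  · exact .inr h.le

theorem le_total_of_le_of_le {a b t : T} (ha : a ≤ t) (hb : b ≤ t) : a ≤ b ∨ b ≤ a := by
  rcases ha.eq_or_lt with rfl | ha
  · exact .inr hb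
  rcases hb.eq_or_lt with rfl | hb
  · exact .inl ha.le
  exact (isChain_Iio t).total ha hb

theorem forall_branchLength_lt_ord_succ_iff {κ : Cardinal.{u}} :
    (∀ (b : Set T) (hb : IsBranch b), branchLength b hb < (Order.succ κ).ord) ↔
      ∀ C : Set T, IsChain (· ≤ ·) C → #C ≤ κ := by
  have lt_iff {b : Set T} (hb : IsBranch b) :
      branchLength b hb < (Order.succ κ).ord ↔ #b ≤ κ := by
    rw [branchLength, lt_ord, Ordinal.card_type, Order.lt_succ_iff]
  refine ⟨fun h C hC => ?_, fun h b hb => (lt_iff hb).2 (h b hb.isChain)⟩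
  obtain ⟨b, hb, hCb⟩ := hC.exists_maxChain
  exact (mk_le_mk_of_subset hCb).trans ((lt_iff hb).1 (h b hb))

theorem exists_isLeast_of_connected_induce_comparabilityGraph {X : Set T}
    (hX : ((comparabilityGraph T).induce X).Connected) : ∃ m, IsLeast X m := by
  obtain ⟨m, hm, hmin⟩ := (wellFounded_lt T).has_min X (Set.nonempty_coe_sort.1 hX.nonempty)
  refine ⟨m, hm, fun y hy => ?_⟩
  by_contra hmy
  obtain ⟨p⟩ := hX.preconnected ⟨m, hm⟩ ⟨y, hy⟩
  obtain ⟨e, -, hfst, hsnd⟩ := p.exists_boundary_dart {z | m ≤ z.1} le_rfl hmy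
  have hadj : (comparabilityGraph T).Adj e.fst e.snd := e.adj
  refine hsnd (hadj.2.elim hfst.trans fun hle => ?_)
  rcases le_total_of_le_of_le hfst hle with h | h
  · exact h
  · exact (h.eq_or_lt.resolve_right (hmin _ e.snd.2)).ge

/- Two elements below a common one are comparable, so the least elements of the branch sets form a
chain. -/
theorem exists_injective_isChain_range_of_isMinor {W : Type v}
    (h : IsMinor (⊤ : SimpleGraph W) (comparabilityGraph T)) :
    ∃ m : W → T, Function.Injective m ∧ IsChain (· ≤ ·) (Set.range m) := by
  obtain ⟨X, hdisj, hconn, hadj⟩ := h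
  choose m hm using fun a => exists_isLeast_of_connected_induce_comparabilityGraph (hconn a)
  refine ⟨m, fun a b hab => ?_, ?_⟩
  · by_contra hne
    exact Set.disjoint_left.1 (hdisj hne) (hm a).1 (hab ▸ (hm b).1)
  · rintro _ ⟨a, rfl⟩ _ ⟨b, rfl⟩ hne
    obtain ⟨x, hx, y, hy, -, hxy | hyx⟩ := hadj a b fun hab => hne (congrArg m hab)
    · exact le_total_of_le_of_le (((hm a).2 hx).trans hxy) ((hm b).2 hy)
    · exact le_total_of_le_of_le ((hm a).2 hx) (((hm b).2 hy).trans hyx)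

theorem not_isMinor_comparabilityGraph {κ : Cardinal.{u}}
    (h : ∀ C : Set T, IsChain (· ≤ ·) C → #C ≤ κ) :
    ¬ IsMinor (completeGraphCard (Order.succ κ)) (comparabilityGraph T) := by
  intro hminor
  obtain ⟨m, hm, hchain⟩ := exists_injective_isChain_range_of_isMinor hminor
  have hle := h _ hchain
  rw [mk_range_eq m hm, mk_ord_toType] at hle
  exact (Order.lt_succ κ).not_ge hle

end Tree

section Core

variable {V : Type u} {G : SimpleGraph V} {κ : Cardinal.{u}}

theorem connected_induce_image_val {D : Set V} {P : Set D}
    (h : ((G.induce D).induce P).Connected) : (G.induce (Subtype.val '' P)).Connected :=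
  h.map (f := ⟨fun x => ⟨x.1.1, x.1, x.2, rfl⟩, fun h => h⟩) (by
    rintro ⟨_, x, hx, rfl⟩
    exact ⟨⟨x, hx⟩, rfl⟩)

theorem connected_induce_componentCompl {K : Set V} (C : G.ComponentCompl K) :
    (G.induce (C : Set V)).Connected := by
  have hC : (C : Set V) = Subtype.val '' SimpleGraph.ConnectedComponent.supp C := by
    ext v
    constructor
    · rintro ⟨hv, h⟩
      exact ⟨⟨v, hv⟩, h, rfl⟩
    · rintro ⟨v, h, rfl⟩
      exact ⟨v.2, h⟩
  rw [hC]
  exact connected_induce_image_val C.connected_toSimpleGraph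

theorem exists_superset_connected_induce_mk_le (hG : G.Connected) (S : Set V) :
    ∃ P, S ⊆ P ∧ (G.induce P).Connected ∧ #P ≤ max ℵ₀ #S := by
  obtain ⟨v⟩ := hG.nonempty
  let p (w : V) : G.Walk v w := (hG.preconnected v w).some
  let P : Set V := insert v (⋃ w : S, {x | x ∈ (p w).support})
  have support_subset (w : S) : {x | x ∈ (p w).support} ⊆ P :=
    fun x hx => .inr (Set.mem_iUnion.2 ⟨w, hx⟩)
  refine ⟨P, fun w hw => support_subset ⟨w, hw⟩ (p w).end_mem_support, ?_, ?_⟩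
  · refine G.induce_connected_of_patches v (Set.mem_insert _ _) fun {x} hx => ?_
    rcases hx with rfl | hx
    · exact ⟨{x}, by simp [P], rfl, rfl, .rfl⟩
    · obtain ⟨w, hw⟩ := Set.mem_iUnion.1 hx
      exact ⟨_, support_subset w, (p w).start_mem_support, hw,
        (p w).connected_induce_support.preconnected _ _⟩
  · have hω : ℵ₀ ≤ max ℵ₀ #S := le_max_left _ _
    refine mk_insert_le.trans (add_le_of_le hω ?_ (one_le_aleph0.trans hω))
    refine (mk_iUnion_le _).trans (mul_le_of_le hω (le_max_right _ _) (ciSup_le' fun w => ?_))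
    exact (List.finite_toSet _).lt_aleph0.le.trans hω

theorem exists_subset_superset_connected_induce_mk_le {D S : Set V} (hD : (G.induce D).Connected)
    (hS : S ⊆ D) : ∃ P ⊆ D, S ⊆ P ∧ (G.induce P).Connected ∧ #P ≤ max ℵ₀ #S := by
  obtain ⟨P, hSP, hP, hcard⟩ :=
    exists_superset_connected_induce_mk_le hD (Subtype.val ⁻¹' S : Set D)
  refine ⟨Subtype.val '' P, Subtype.coe_image_subset D P,
    fun x hx => ⟨⟨x, hS hx⟩, hSP hx, rfl⟩, connected_induce_image_val hP,
    mk_image_le.trans (hcard.trans (max_le_max_left _ ?_))⟩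
  exact mk_preimage_of_injective _ _ Subtype.val_injective

variable (G) in
/-- The outer vertex boundary of a vertex set: the vertices outside it with a neighbor in it. -/
def outerBoundary (D : Set V) : Set V :=
  {v | v ∉ D ∧ ∃ x ∈ D, G.Adj v x}

theorem inter_outerBoundary_nonempty {D E : Set V} (hE : (G.induce E).Connected) (hD : D.Nonempty)
    (hDE : D ⊂ E) : (E ∩ outerBoundary G D).Nonempty := by
  obtain ⟨x, hx⟩ := hD
  obtain ⟨y, hyE, hyD⟩ := Set.exists_of_ssubset hDE
  obtain ⟨p⟩ := hE.preconnected ⟨x, hDE.subset hx⟩ ⟨y, hyE⟩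
  obtain ⟨e, -, hfst, hsnd⟩ := p.exists_boundary_dart (Subtype.val ⁻¹' D) hx hyD
  exact ⟨e.snd, e.snd.2, hsnd, e.fst, hfst, e.adj.symm⟩

theorem outerBoundary_componentCompl_subset {K : Set V} (C : G.ComponentCompl K) :
    outerBoundary G C ⊆ K := by
  rintro v ⟨hv, x, hx, hadj⟩
  by_contra hvK
  exact hv (C.mem_of_adj x v hx hvK hadj.symm)

variable (G κ) in
/-- A `κ`-core of a vertex set `D`: a connected subset of `D` with at most `κ` vertices which sees
the whole outer boundary of `D`, so that it can stand in for `D` as a branch set of a minor. -/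
structure IsCore (D P : Set V) : Prop where
  subset : P ⊆ D
  connected : (G.induce P).Connected
  mk_le : #P ≤ κ
  exists_adj : ∀ v ∈ outerBoundary G D, ∃ x ∈ P, G.Adj v x

theorem exists_isCore (hκ : ℵ₀ ≤ κ) {D : Set V} (hD : (G.induce D).Connected)
    (h : #(outerBoundary G D) ≤ κ) : ∃ P, IsCore G κ D P := by
  choose neighbor mem adj using fun v : outerBoundary G D => v.2.2
  obtain ⟨P, hPD, hP, hconn, hcard⟩ :=
    exists_subset_superset_connected_induce_mk_le hD (Set.range_subset_iff.2 mem)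
  exact ⟨P, hPD, hconn, hcard.trans (max_le hκ (mk_range_le.trans h)),
    fun v hv => ⟨neighbor ⟨v, hv⟩, hP ⟨_, rfl⟩, adj ⟨v, hv⟩⟩⟩

variable (G κ) in
open Classical in
/-- A chosen `κ`-core of `D`, or the empty set if `D` has none. -/
noncomputable def core (D : Set V) : Set V :=
  if h : ∃ P, IsCore G κ D P then h.choose else ∅

theorem core_subset (D : Set V) : core G κ D ⊆ D := by
  rw [core]
  split_ifs with h
  · exact h.choose_spec.subset
  · exact Set.empty_subset _

theorem isCore_core {D : Set V} (h : ∃ P, IsCore G κ D P) : IsCore G κ D (core G κ D) := by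
  rw [core, dif_pos h]
  exact h.choose_spec

end Core

section Decomposition

variable {V : Type u} {I : Type u} [LinearOrder I]

/-- The vertices removed before stage `i` of the transfinite process which, at each stage, removes
the chosen `κ`-core of every component of what is left of the graph. -/
noncomputable def removed [WellFoundedLT I] (G : SimpleGraph V) (κ : Cardinal.{u}) (i : I) :
    Set V :=
  {v | ∃ j, ∃ _ : j < i, ∃ C : G.ComponentCompl (removed G κ j), v ∈ core G κ (C : Set V)}
termination_by _root_.wellFounded_lt.wrap i

variable [WellFoundedLT I] {G : SimpleGraph V} {κ : Cardinal.{u}} {i j : I}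

theorem mem_removed {v : V} : v ∈ removed G κ i ↔
    ∃ j < i, ∃ C : G.ComponentCompl (removed G κ j), v ∈ core G κ (C : Set V) := by
  rw [removed]
  simp only [exists_prop, Set.mem_ofPred_eq]

theorem removed_mono : Monotone (removed (I := I) G κ) := by
  intro i j hij v hv
  obtain ⟨k, hk, hv⟩ := mem_removed.1 hv
  exact mem_removed.2 ⟨k, hk.trans_le hij, hv⟩

theorem core_subset_removed (C : G.ComponentCompl (removed G κ i)) (hij : i < j) :
    core G κ (C : Set V) ⊆ removed G κ j :=
  fun _ hv => mem_removed.2 ⟨i, hij, C, hv⟩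

theorem le_of_mem_core_of_notMem_removed {C : G.ComponentCompl (removed G κ j)} {v : V}
    (hv : v ∈ core G κ (C : Set V)) (hvi : v ∉ removed G κ i) : i ≤ j :=
  le_of_not_gt fun hji => hvi (core_subset_removed C hji hv)

theorem disjoint_core (C : G.ComponentCompl (removed G κ i))
    (D : G.ComponentCompl (removed G κ j)) (hij : i < j) :
    Disjoint (core G κ (C : Set V)) (core G κ (D : Set V)) :=
  D.disjoint_right.mono (core_subset_removed C hij) (core_subset _)

theorem outerBoundary_subset_iUnion_core (C : G.ComponentCompl (removed G κ i)) :
    outerBoundary G C ⊆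
      ⋃ j : Set.Iio i, core G κ (C.hom (removed_mono j.2.le) : Set V) := by
  intro v hv
  obtain ⟨j, hji, D, hvD⟩ := mem_removed.1 (outerBoundary_componentCompl_subset C hv)
  obtain ⟨-, x, hxC, hadj⟩ := hv
  have hx : x ∈ D :=
    D.mem_of_adj v x (core_subset _ hvD)
      (fun h => C.notMem_of_mem hxC (removed_mono hji.le h)) hadj
  have hD : C.hom (removed_mono hji.le) = D :=
    (C.hom_eq_iff_not_disjoint _ D).2 (Set.not_disjoint_iff.2 ⟨x, hxC, hx⟩)
  exact Set.mem_iUnion.2 ⟨⟨j, hji⟩, hD ▸ hvD⟩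

theorem isCore_core_componentCompl (hκ : ℵ₀ ≤ κ) (hi : #(Set.Iio i) ≤ κ)
    (C : G.ComponentCompl (removed G κ i)) : IsCore G κ C (core G κ (C : Set V)) := by
  induction i using WellFoundedLT.induction with
  | ind i ih =>
    refine isCore_core (exists_isCore hκ (connected_induce_componentCompl C) ?_)
    refine (mk_le_mk_of_subset (outerBoundary_subset_iUnion_core C)).trans
      ((mk_iUnion_le _).trans (mul_le_of_le hκ hi (ciSup_le' fun j => ?_)))
    exact (ih j j.2 ((mk_le_mk_of_subset (Set.Iio_subset_Iio j.2.le)).trans hi) _).mk_le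

section Thread

variable {d : ∀ i : I, G.ComponentCompl (removed G κ i)}

theorem exists_core_inter_outerBoundary_nonempty (hd : Antitone fun i => (d i : Set V))
    (hne : (core G κ (d j : Set V)).Nonempty) (hji : j < i) :
    ∃ k, j ≤ k ∧ k < i ∧ (core G κ (d k : Set V) ∩ outerBoundary G (d i)).Nonempty := by
  have hssub : (d i : Set V) ⊂ d j := by
    obtain ⟨x, hx⟩ := hne
    refine ⟨hd hji.le, fun h => ?_⟩
    exact (d i).notMem_of_mem (h (core_subset _ hx)) (core_subset_removed _ hji hx)
  obtain ⟨v, hvj, hv⟩ :=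
    inter_outerBoundary_nonempty (connected_induce_componentCompl (d j)) (d i).nonempty hssub
  obtain ⟨⟨k, hki⟩, hvk⟩ := Set.mem_iUnion.1 (outerBoundary_subset_iUnion_core (d i) hv)
  rw [((d i).hom_eq_iff_le _ (d k)).2 (hd (le_of_lt hki))] at hvk
  exact ⟨k, le_of_mem_core_of_notMem_removed hvk ((d j).notMem_of_mem hvj), hki, v, hvk, hv⟩

/- The cores of a thread are disjoint and connected, and the core at stage `k` is joined to the core
at a later stage `i` as soon as it meets the outer boundary of `d i`. This happens for every `i > k`
for cofinally many `k`. -/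
theorem exists_isCofinal_isMinor_top (hκ : ℵ₀ ≤ κ) (hI : ∀ i : I, #(Set.Iio i) ≤ κ)
    (hcof : κ < Order.cof I) (hd : Antitone fun i => (d i : Set V)) :
    ∃ J : Set I, IsCofinal J ∧ IsMinor (⊤ : SimpleGraph J) G := by
  have hcore (i : I) : IsCore G κ (d i) (core G κ (d i : Set V)) :=
    isCore_core_componentCompl hκ (hI i) (d i)
  let Meets (k i : I) : Prop := (core G κ (d k : Set V) ∩ outerBoundary G (d i)).Nonempty
  have meets_anti ⦃k i i' : I⦄ (hki : k < i) (hii' : i ≤ i') : Meets k i' → Meets k i := by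
    rintro ⟨v, hv, -, x, hx, hadj⟩
    exact ⟨v, hv, fun h => (d i).notMem_of_mem h (core_subset_removed _ hki hv),
      x, hd hii' hx, hadj⟩
  have adj_of_meets {k i : I} : Meets k i →
      ∃ x ∈ core G κ (d k : Set V), ∃ y ∈ core G κ (d i : Set V), G.Adj x y :=
    fun ⟨v, hv, hvi⟩ => ⟨v, hv, (hcore i).exists_adj v hvi⟩
  refine ⟨{k | ∀ i, k < i → Meets k i},
    isCofinal_setOf_forall_gt (fun i => (hI i).trans_lt hcof) (hκ.trans_lt hcof) meets_anti
      fun j i hji => exists_core_inter_outerBoundary_nonempty hd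
        (Set.nonempty_coe_sort.1 (hcore j).connected.nonempty) hji,
    fun a => core G κ (d a : Set V), fun a b hab => ?_, fun a => (hcore a).connected,
    fun a b hab => ?_⟩
  · rcases lt_or_gt_of_ne (Subtype.coe_injective.ne hab) with h | h
    · exact disjoint_core _ _ h
    · exact (disjoint_core _ _ h).symm
  · rcases lt_or_gt_of_ne (Subtype.coe_injective.ne hab.ne) with h | h
    · exact adj_of_meets (a.2 b h)
    · obtain ⟨x, hx, y, hy, hxy⟩ := adj_of_meets (b.2 a h)
      exact ⟨y, hy, x, hx, hxy.symm⟩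

end Thread

variable (I G κ) in
/-- A vertex set is never separated by the removal process with stages `I` if, at every stage, all
its remaining vertices lie in the same component. -/
def NeverSeparated (X : Set V) : Prop :=
  ∀ ⦃u⦄, u ∈ X → ∀ ⦃v⦄, v ∈ X → ∀ ⦃i : I⦄ (hu : u ∉ removed G κ i) (hv : v ∉ removed G κ i),
    G.componentComplMk hu = G.componentComplMk hv

theorem neverSeparated_singleton (v : V) : NeverSeparated I G κ {v} := by
  rintro _ rfl _ rfl i _ _
  rfl

theorem NeverSeparated.exists_subset_removed {X : Set V} (hX : NeverSeparated I G κ X)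
    (hκ : ℵ₀ ≤ κ) (hI : ∀ i : I, #(Set.Iio i) ≤ κ) (hcof : κ < Order.cof I)
    (hG : ¬ IsMinor (completeGraphCard (Order.succ κ)) G) : ∃ i : I, X ⊆ removed G κ i := by
  by_contra! h
  choose v hvX hv using fun i => Set.not_subset.1 (h i)
  have anti : Antitone fun i : I => (G.componentComplMk (hv i) : Set V) := fun i j hij =>
    (SimpleGraph.ComponentCompl.hom_eq_iff_le _ (removed_mono hij) _).1
      (hX (hvX j) (hvX i) (fun h => hv j (removed_mono hij h)) (hv i))
  obtain ⟨J, hJ, hminor⟩ := exists_isCofinal_isMinor_top hκ hI hcof anti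
  have hcard : #(Order.succ κ).ord.ToType ≤ #J :=
    (mk_ord_toType _).trans_le ((Order.succ_le_of_lt hcof).trans (Order.cof_le hJ))
  obtain ⟨e⟩ := hcard
  exact hG (hminor.of_injective_hom ⟨e, e.injective.ne⟩ e.injective)

theorem NeverSeparated.mk_le {X : Set V} (hX : NeverSeparated I G κ X) (hκ : ℵ₀ ≤ κ)
    (hi : #(Set.Iio i) ≤ κ) (hXi : X ⊆ removed G κ i) : #X ≤ κ := by
  let layer (j : I) : Set V :=
    {v | v ∈ X ∧ ∃ C : G.ComponentCompl (removed G κ j), v ∈ core G κ (C : Set V)}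
  have subset_layers : X ⊆ ⋃ j : Set.Iio i, layer j := fun v hv =>
    let ⟨j, hji, hC⟩ := mem_removed.1 (hXi hv)
    Set.mem_iUnion.2 ⟨⟨j, hji⟩, hv, hC⟩
  refine (mk_le_mk_of_subset subset_layers).trans ((mk_iUnion_le _).trans
    (mul_le_of_le hκ hi (ciSup_le' fun j => ?_)))
  rcases (layer j).eq_empty_or_nonempty with h | ⟨u, hu, C, huC⟩
  · simp only [h, mk_eq_zero, zero_le]
  have layer_subset_core : layer j ⊆ core G κ (C : Set V) := by
    rintro v ⟨hv, D, hvD⟩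
    obtain ⟨huj, rfl⟩ := core_subset _ huC
    obtain ⟨hvj, rfl⟩ := core_subset _ hvD
    exact hX hv hu hvj huj ▸ hvD
  exact (mk_le_mk_of_subset layer_subset_core).trans
    (isCore_core_componentCompl hκ ((mk_le_mk_of_subset (Set.Iio_subset_Iio j.2.le)).trans hi)
      C).mk_le

end Decomposition

section NormalOrder

variable {V : Type u} {G : SimpleGraph V} {κ : Cardinal.{u}}

theorem exists_isOrderTree_of_laminar {K : Type*} [LinearOrder K] [WellFoundedLT K] {key : V → K}
    (hkey : Function.Injective key) {S : V → Set V} (hmem : ∀ v, v ∈ S v)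
    (hlaminar : ∀ u v, key u ≤ key v → ¬ Disjoint (S u) (S v) → S v ⊆ S u) :
    ∃ _ : PartialOrder V, IsOrderTree V ∧ ∀ u v, u ≤ v ↔ key u ≤ key v ∧ v ∈ S u := by
  have subset_of_mem {u v t : V} (h : key u ≤ key v) (hu : t ∈ S u) (hv : t ∈ S v) : S v ⊆ S u :=
    hlaminar u v h (Set.not_disjoint_iff.2 ⟨t, hu, hv⟩)
  let order : PartialOrder V :=
    { le u v := key u ≤ key v ∧ v ∈ S u
      le_refl v := ⟨le_rfl, hmem v⟩
      le_trans u v w huv hvw :=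
        ⟨huv.1.trans hvw.1, subset_of_mem huv.1 huv.2 (hmem v) hvw.2⟩
      le_antisymm u v huv hvu := hkey (huv.1.antisymm hvu.1) }
  refine ⟨order, ⟨fun t => ?_⟩, fun _ _ => Iff.rfl⟩
  have le_of_key_le {a b : V} (ha : a ≤ t) (hb : b ≤ t) (h : key a ≤ key b) : a ≤ b :=
    ⟨h, subset_of_mem h ha.2 hb.2 (hmem b)⟩
  have key_lt {a b : V} (hab : a < b) : key a < key b :=
    hab.le.1.lt_of_ne (hkey.ne hab.ne)
  exact
    { wf := Subrelation.wf (fun {a b} (hab : a.1 < b.1) => key_lt hab)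
        (InvImage.wf (fun a : Set.Iio t => key a.1) _root_.wellFounded_lt)
      trichotomous := fun a b hab hba => by
        rcases le_total (key a.1) (key b.1) with h | h
        · exact Subtype.ext ((le_of_key_le a.2.le b.2.le h).eq_or_lt.resolve_right hab)
        · exact Subtype.ext ((le_of_key_le b.2.le a.2.le h).eq_or_lt.resolve_right hba).symm }

theorem exists_isOrderTree_le_comparabilityGraph_forall_neverSeparated {I : Type u} [LinearOrder I]
    [WellFoundedLT I]
    (h : ∀ v : V, ∃ i : I, ∃ C : G.ComponentCompl (removed G κ i), v ∈ core G κ (C : Set V)) :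
    ∃ _ : PartialOrder V, IsOrderTree V ∧ G ≤ comparabilityGraph V ∧
      ∀ X : Set V, IsChain (· ≤ ·) X → NeverSeparated I G κ X := by
  choose rank C hC using h
  have mem_C (v : V) : v ∈ C v := core_subset _ (hC v)
  let key (v : V) : I ×ₗ Cardinal.{u} := toLex (rank v, embeddingToCardinal v)
  have hkey : Function.Injective key := fun a b hab =>
    embeddingToCardinal.injective (congrArg (fun x => (ofLex x).2) hab)
  have removed_subset {u v : V} (huv : key u ≤ key v) :
      removed G κ (rank u) ⊆ removed G κ (rank v) :=
    removed_mono (Prod.Lex.monotone_fst_ofLex huv)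
  obtain ⟨order, htree, le_iff⟩ := exists_isOrderTree_of_laminar hkey mem_C fun u v huv hdisj =>
    ((C v).hom_eq_iff_le (removed_subset huv) (C u)).1
      (((C v).hom_eq_iff_not_disjoint (removed_subset huv) (C u)).2 fun h => hdisj h.symm)
  have le_of_adj {u v : V} (huv : G.Adj u v) (hle : key u ≤ key v) : u ≤ v :=
    (le_iff u v).2 ⟨hle, (C u).mem_of_adj u v (mem_C u)
      (fun h => (C v).notMem_of_mem (mem_C v) (removed_subset hle h)) huv⟩
  have eq_of_le {u v : V} (huv : u ≤ v) {i : I} (hu : u ∉ removed G κ i)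
      (hv : v ∉ removed G κ i) : G.componentComplMk hu = G.componentComplMk hv := by
    have hi : removed G κ i ⊆ removed G κ (rank u) :=
      removed_mono (le_of_mem_core_of_notMem_removed (hC u) hu)
    obtain ⟨_, hu'⟩ := (C u).subset_hom hi (mem_C u)
    obtain ⟨_, hv'⟩ := (C u).subset_hom hi ((le_iff u v).1 huv).2
    exact hu'.trans hv'.symm
  refine ⟨order, htree, fun u v huv => ⟨huv.ne, ?_⟩, fun X hX u hu v hv i hui hvi => ?_⟩
  · exact (le_total (key u) (key v)).imp (le_of_adj huv) (le_of_adj huv.symm)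
  · rcases hX.total hu hv with h | h
    · exact eq_of_le h hui hvi
    · exact (eq_of_le h hvi hui).symm

theorem exists_isOrderTree_le_comparabilityGraph (hκ : ℵ₀ ≤ κ)
    (hG : ¬ IsMinor (completeGraphCard (Order.succ κ)) G) :
    ∃ _ : PartialOrder V, IsOrderTree V ∧ G ≤ comparabilityGraph V ∧
      ∀ X : Set V, IsChain (· ≤ ·) X → #X ≤ κ := by
  have exists_subset_removed {X : Set V} (hX : NeverSeparated (Order.succ κ).ord.ToType G κ X) :
      ∃ i : (Order.succ κ).ord.ToType, X ⊆ removed G κ i :=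
    hX.exists_subset_removed hκ mk_Iio_toType_ord_succ_le
      ((Order.lt_succ κ).trans_eq (cof_toType_ord_succ hκ).symm) hG
  have exists_mem_core (v : V) : ∃ i : (Order.succ κ).ord.ToType,
      ∃ C : G.ComponentCompl (removed G κ i), v ∈ core G κ (C : Set V) := by
    obtain ⟨i, hi⟩ := exists_subset_removed (neverSeparated_singleton v)
    obtain ⟨j, -, hj⟩ := mem_removed.1 (hi rfl)
    exact ⟨j, hj⟩
  obtain ⟨order, htree, hle, hchain⟩ :=
    exists_isOrderTree_le_comparabilityGraph_forall_neverSeparated exists_mem_core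
  refine ⟨order, htree, hle, fun X hX => ?_⟩
  obtain ⟨i, hi⟩ := exists_subset_removed (hchain X hX)
  exact (hchain X hX).mk_le hκ (mk_Iio_toType_ord_succ_le i) hi

end NormalOrder

end HadwigerTree

theorem mainTheorem1 (κ μ : Cardinal.{u}) (hκ : ℵ₀ ≤ κ) (hμ : ℵ₀ ≤ μ) :
    (∃ (V : Type u) (G : SimpleGraph V),
        #V = μ ∧
        HadwigerTree.chromaticCard G = Order.succ κ ∧
        ¬ HadwigerTree.IsMinor (HadwigerTree.completeGraphCard (Order.succ κ)) G) ↔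
    (∃ (T : Type u) (_ : PartialOrder T) (_ : HadwigerTree.IsOrderTree T),
        #T = μ ∧
        ¬ HadwigerTree.IsSpecial κ T ∧
        ∀ (b : Set T) (hb : HadwigerTree.IsBranch b),
          HadwigerTree.branchLength b hb < (Order.succ κ).ord) := by
  constructor
  · rintro ⟨V, G, hV, hχ, hG⟩
    obtain ⟨order, htree, hle, hchain⟩ :=
      HadwigerTree.exists_isOrderTree_le_comparabilityGraph hκ hG
    refine ⟨V, order, htree, hV, fun hspecial => (Order.lt_succ κ).not_ge ?_,
      HadwigerTree.forall_branchLength_lt_ord_succ_iff.2 hchain⟩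
    rw [← hχ]
    exact (HadwigerTree.chromaticCard_mono hle).trans
      (HadwigerTree.isSpecial_iff_chromaticCard_le.1 hspecial)
  · rintro ⟨T, order, htree, hT, hspecial, hbranch⟩
    have hchain := HadwigerTree.forall_branchLength_lt_ord_succ_iff.1 hbranch
    have : WellFoundedLT T := ⟨HadwigerTree.wellFounded_lt T⟩
    refine ⟨T, HadwigerTree.comparabilityGraph T, hT, le_antisymm ?_ ?_,
      HadwigerTree.not_isMinor_comparabilityGraph hchain⟩
    · exact HadwigerTree.chromaticCard_comparabilityGraph_le hκ fun t =>
        hchain _ (HadwigerTree.isChain_Iio t)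
    · rw [HadwigerTree.isSpecial_iff_chromaticCard_le, not_le] at hspecial
      exact Order.succ_le_of_lt hspecial
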